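/- Let $\mathbb R_{0,m}$ be the real Clifford algebra generated by $e_1,\dots,e_m$ with $e_je_l+e_le_j=-2\delta_{jl}$, identify $x\in\mathbb R^m$ with $\underline x=\sum_j x_je_j$, let $r=|\underline x|$, $\underline\omega=\underline x/r$, and let $\partial_{\underline x}=\sum_{j=1}^m e_j\partial_{x_j}$. A $C^1$ function $F$ on an open subset of $\mathbb R^{m+1}$ with values in $\mathbb R_{0,m}$ is monogenic if $(\partial_{x_0}+\partial_{\underline x})F=0$. Let $m\ge 1$ be odd, $k\ge 0$, $(m,k)\neq(1,0)$, let $P_k$ be an $\mathbb R_{0,m}$-valued homogeneous polynomial of degree $k$ on $\mathbb R^m$ with $\partial_{\underline x}P_k=0$, and let $\alpha\in\mathbb R\setminus\{-1,-2,\dots,-k-\frac{m-1}2\}$. Put $\beta=\alpha+k+\frac{m-1}2$, $Z=x_0+ir$, $$Q_0^{(\beta)}=1,\qquad Q_{n+1}^{(\beta)}(z)=2(\beta-n)\,z\,Q_n^{(\beta)}(z)+(1+z^2)\,\frac{d}{dz}Q_n^{(\beta)}(z),$$ $$a_{n,m,k}=\frac{(-i)^{n}(2k+m-n-2)!}{(2k+m-2n-1)!!\,(n-1)!},\qquad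 b_{n,m,k}=\frac{(-i)^{n+1}(2k+m-n-1)!}{(2k+m-2n-1)!!\,n!},$$ with $0!!=1$ and all complex powers taken on the principal branch. Then the function $g(\underline x)=(1-|\underline x|^2)^\alpha P_k(\underline x)$, $|\underline x|<1$, has a Cauchy–Kowalevski extension $F=\mathsf{CK}[g]$ on $\{(x_0,\underline x)\in\mathbb R^{m+1}:|\underline x|<1\}$: the function $F$ is monogenic there, $F(0,\underline x)=g(\underline x)$, and $$F(x_0,\underline x)=\sum_{n=0}^\infty\frac{(-x_0)^n}{n!}\,\partial_{\underline x}^n g(\underline x)\qquad\text{(convergent) whenever } |x_0|+|\underline x|<1 .$$ Moreover, for all $x_0\in\mathbb R$ and all $\underline x$ with $0<|\underline x|<1$, $$2^{k+\frac{m+1}{2}}\Bigl(\prod_{n=1}^{k+\frac{m-1}{2}}(\alpha+n)\Bigr)F(x_0,\underline x)=\bigl(A+\underline\omega\,B\bigr)P_k(\underline x),$$ where $$A=\sum_{n=1}^{k+\frac{m-1}{2}}\frac{a_{n,m,k}}{r^{2k+m-n-1}}\Bigl((1+Z^2)^{\beta-n}Q_n^{(\beta)}(Z)+(-1)^{n}(1+\overline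 Z^2)^{\beta-n}Q_n^{(\beta)}(\overline Z)\Bigr),$$ $$B=\sum_{n=0}^{k+\frac{m-1}{2}}\frac{b_{n,m,k}}{r^{2k+m-n-1}}\Bigl((1+Z^2)^{\beta-n}Q_n^{(\beta)}(Z)+(-1)^{n+1}(1+\overline Z^2)^{\beta-n}Q_n^{(\beta)}(\overline Z)\Bigr),$$ and $A$ and $B$ are real numbers. -/

import Mathlib

open scoped Nat

noncomputable section

namespace CliffordCK

/-- Euclidean space `ℝ^m`. -/
abbrev E (m : ℕ) : Type := EuclideanSpace ℝ (Fin m)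

/-- The quadratic form `x ↦ -|x|²` on `ℝ^m`. -/
def negNormSq (m : ℕ) : QuadraticForm ℝ (E m) :=
  -(LinearMap.BilinMap.toQuadraticMap (innerₗ (E m)))

theorem negNormSq_apply (m : ℕ) (x : E m) : negNormSq m x = -‖x‖ ^ 2 := by
  simp [negNormSq, LinearMap.BilinMap.toQuadraticMap_apply]

/-- The real Clifford algebra `ℝ_{0,m}`, with `e_j e_k + e_k e_j = -2 δ_{jk}`. -/
abbrev Cl (m : ℕ) : Type := CliffordAlgebra (negNormSq m)

/-- A vector of `ℝ^m` regarded as an element of `ℝ_{0,m}`. -/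
def vec {m : ℕ} (x : E m) : Cl m := CliffordAlgebra.ι (negNormSq m) x

/-- The generator `e_j` of `ℝ_{0,m}`. -/
def e {m : ℕ} (j : Fin m) : Cl m := vec (EuclideanSpace.single j 1)

theorem e_mul_e_add {m : ℕ} (j l : Fin m) :
    (e j * e l + e l * e j : Cl m) = algebraMap ℝ (Cl m) (if j = l then -2 else 0) := by
  rw [e, e, vec, vec, CliffordAlgebra.ι_mul_ι_add_swap]
  congr 1
  simp only [QuadraticMap.polar, negNormSq_apply, @norm_add_sq_real]
  by_cases h : j = l
  · subst h
    simp
  · simp [EuclideanSpace.inner_single_left, h]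

/-- The linear isomorphism of `ℝ_{0,m}` with `ℝ^(2^m)` given by the coordinates
`(a_A)`, `A ⊆ {1,…,m}`. -/
def coords (m : ℕ) : Cl m ≃ₗ[ℝ] EuclideanSpace ℝ (Finset (Fin m)) :=
  (CliffordAlgebra.equivExterior (negNormSq m)).trans
    (((EuclideanSpace.basisFun (Fin m) ℝ).toBasis.ExteriorAlgebra.equivFun).trans
      (WithLp.linearEquiv 2 ℝ (Finset (Fin m) → ℝ)).symm)

/-- The Euclidean norm of the coordinates. Its only role is to fix the (unique) vector space
topology of the finite-dimensional space `ℝ_{0,m}`. -/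
instance instNormedAddCommGroupCl (m : ℕ) : NormedAddCommGroup (Cl m) :=
  NormedAddCommGroup.induced (Cl m) (EuclideanSpace ℝ (Finset (Fin m)))
    (coords m).toLinearMap (coords m).injective

instance instNormedSpaceCl (m : ℕ) : NormedSpace ℝ (Cl m) :=
  NormedSpace.induced ℝ (Cl m) (EuclideanSpace ℝ (Finset (Fin m))) (coords m).toLinearMap

/-- The Dirac operator `∂_x = ∑_j e_j ∂_{x_j}` on `ℝ^m`. -/
def dirac {m : ℕ} (f : E m → Cl m) (x : E m) : Cl m :=
  ∑ j, e j * fderiv ℝ f x (EuclideanSpace.single j 1)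

/-- The generalized Cauchy-Riemann operator `∂_{x₀} + ∂_x` on `ℝ^{m+1} = ℝ × ℝ^m`. -/
def cauchyRiemann {m : ℕ} (F : ℝ × E m → Cl m) (p : ℝ × E m) : Cl m :=
  fderiv ℝ F p (1, 0) + ∑ j, e j * fderiv ℝ F p (0, EuclideanSpace.single j 1)

/-- `F` is monogenic in the open set `Ω ⊆ ℝ^{m+1}`. -/
def MonogenicOn {m : ℕ} (F : ℝ × E m → Cl m) (Ω : Set (ℝ × E m)) : Prop :=
  ContDiffOn ℝ 1 F Ω ∧ ∀ p ∈ Ω, cauchyRiemann F p = 0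

/-- `P : ℝ^m → ℝ_{0,m}` is a homogeneous polynomial of degree `k`
with coefficients in `ℝ_{0,m}`. -/
def IsHomogeneousPolynomial {m : ℕ} (k : ℕ) (P : E m → Cl m) : Prop :=
  ∃ c : (Fin m → ℕ) → Cl m, ∀ x : E m,
    P x = ∑ d ∈ Finset.piAntidiag Finset.univ k, (∏ j, x j ^ d j) • c d

/-- The `n`-th term `((-x₀)^n / n!) ∂_x^n g(x)` of the Cauchy-Kowalevski extension of `g`. -/
def ckTerm {m : ℕ} (g : E m → Cl m) (p : ℝ × E m) (n : ℕ) : Cl m :=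
  ((-p.1) ^ n / (n ! : ℝ)) • (dirac^[n] g) p.2

/-- The function `(1 - |x|²)^α P(x)`. -/
def weighted {m : ℕ} (α : ℝ) (P : E m → Cl m) (x : E m) : Cl m :=
  ((1 - ‖x‖ ^ 2) ^ α) • P x

/-- The polynomials `Q_n^{(β)}`. -/
def Q (β : ℝ) : ℕ → Polynomial ℝ
  | 0 => 1
  | n + 1 => Polynomial.C (2 * (β - n)) * Polynomial.X * Q β n
      + (1 + Polynomial.X ^ 2) * Polynomial.derivative (Q β n)

/-- `(1 + z²)^{β-n} Q_n^{(β)}(z)`, with the principal branch of the power. -/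
def powQ (β : ℝ) (n : ℕ) (z : ℂ) : ℂ :=
  (1 + z ^ 2) ^ ((β - n : ℝ) : ℂ) * Polynomial.aeval z (Q β n)

/-- The coefficient `a_{n,m,k}` (used for `1 ≤ n ≤ k + (m-1)/2`). -/
def a (n m k : ℕ) : ℂ :=
  (-Complex.I) ^ n * ((2 * k + m - n - 2)! : ℂ)
    / (((2 * k + m - 2 * n - 1)‼ : ℂ) * ((n - 1)! : ℂ))

/-- The coefficient `b_{n,m,k}` (used for `0 ≤ n ≤ k + (m-1)/2`). -/
def b (n m k : ℕ) : ℂ :=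
  (-Complex.I) ^ (n + 1) * ((2 * k + m - n - 1)! : ℂ)
    / (((2 * k + m - 2 * n - 1)‼ : ℂ) * (n ! : ℂ))

/-- The scalar sum of the closed formula, with `β = α + k + (m-1)/2` and `Z = x₀ + i r`. -/
def sumA (m k : ℕ) (α x₀ r : ℝ) : ℂ :=
  let β : ℝ := α + k + ((m : ℝ) - 1) / 2
  let Z : ℂ := x₀ + Complex.I * r
  ∑ n ∈ Finset.Icc 1 (k + (m - 1) / 2), a n m k / (r : ℂ) ^ (2 * k + m - n - 1) *
    (powQ β n Z + (-1) ^ n * powQ β n (starRingEnd ℂ Z))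

/-- The sum multiplying `ω = x / r` in the closed formula. -/
def sumB (m k : ℕ) (α x₀ r : ℝ) : ℂ :=
  let β : ℝ := α + k + ((m : ℝ) - 1) / 2
  let Z : ℂ := x₀ + Complex.I * r
  ∑ n ∈ Finset.Icc 0 (k + (m - 1) / 2), b n m k / (r : ℂ) ^ (2 * k + m - n - 1) *
    (powQ β n Z + (-1) ^ (n + 1) * powQ β n (starRingEnd ℂ Z))

end CliffordCK

end

noncomputable section

namespace CliffordCK

open Polynomial MeasureTheory Set Filter Topology

/-! Let `h(z) = (1 + z²)^β` on the strip `|Im z| < 1`, where `1 + z²` avoids the branch cut; `powQ β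
n` is then the derivative `h^{(n)}` (`hasDerivAt_powQ`). Everything rests on the integrals
`I_{M,n}(x₀, r) = ∫_{-1}^1 h^{(n)}(x₀ + irt) (1 - t²)^M dt`, with `2M + 3 = m + 2k`, so that `M + 1
= k + (m-1)/2`.

Put `F_n = I_{M,n} P + I_{M+1,n+1} / (2(M+1)) · x P` with `r = |x|`. Integration by parts in `t`
gives `∂_r I_{M,n} = -r I_{M+1,n+2} / (2(M+1))` and a three-term recurrence (`axInt_recurrence`).
Together with `∂_x (x P) = -(m+2k) P` these yield `∂_x F_n = -F_{n+1}`, while `∂_{x₀} F_n = F_{n+1}`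
is immediate. Hence every `F_n` is monogenic, and on `x₀ = 0` iterating the Dirac operator only
raises `n`, up to sign, so the CK series is the Taylor series of `F_n` in `x₀`.

For `n = 2M + 2` and `x₀ = 0` the `xP` part vanishes by parity, and the `P` part is a constant times
`(1 - r²)^{β-M-1} = (1 - r²)^α` (`axInt_zero_left`). Thus `F` is a multiple of `F_{2M+2}`. The
closed formula comes from integrating by parts until the polynomial weight is exhausted: only
boundary terms at `x₀ ± ir` remain (`axInt_eq_sum`). -/

/-- The strip `|Im z| < 1`. -/
def strip : Set ℂ := {z | |z.im| < 1}

theorem isOpen_strip : IsOpen strip :=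
  isOpen_lt (Complex.continuous_im.abs) continuous_const

/-- If `Im (z²) = 2xy` vanishes, then `1 + z²` is `1 - y²` or `1 + x²`, positive in both cases. -/
theorem one_add_sq_mem_slitPlane {z : ℂ} (hz : z ∈ strip) : 1 + z ^ 2 ∈ Complex.slitPlane := by
  rw [Complex.mem_slitPlane_iff]
  by_contra! h
  obtain ⟨h1, h2⟩ := h
  have hz' : z.im ^ 2 < 1 := by
    rw [sq_lt_one_iff_abs_lt_one]; exact hz
  simp [pow_two] at h1 h2
  have h3 : z.re * z.im = 0 := by linarith
  rcases mul_eq_zero.1 h3 with h | h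
  · rw [h] at h1; nlinarith
  · rw [h] at h1; nlinarith

/-- The recursion for `Q` is the product rule after a factor `(1 + z²)^{β-n-1}` is pulled out. -/
theorem hasDerivAt_powQ (β : ℝ) (n : ℕ) {z : ℂ} (hz : z ∈ strip) :
    HasDerivAt (powQ β n) (powQ β (n + 1) z) z := by
  have hs := one_add_sq_mem_slitPlane hz
  have h1 : HasDerivAt (fun z : ℂ => 1 + z ^ 2) (2 * z) z := by
    simpa using (hasDerivAt_pow 2 z).const_add 1
  have h2 := h1.cpow_const (c := ((β - n : ℝ) : ℂ)) hs
  have h3 := h2.mul ((Q β n).hasDerivAt_aeval z)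
  have h0 : (1 + z ^ 2 : ℂ) ≠ 0 := Complex.slitPlane_ne_zero hs
  refine h3.congr_deriv ?_
  have e1 : (1 + z ^ 2 : ℂ) ^ ((β - n : ℝ) : ℂ)
      = (1 + z ^ 2) ^ (((β - n : ℝ) : ℂ) - 1) * (1 + z ^ 2) := by
    rw [Complex.cpow_sub _ _ h0, Complex.cpow_one, div_mul_cancel₀ _ h0]
  have e2 : ((β - (n + 1 : ℕ) : ℝ) : ℂ) = ((β - n : ℝ) : ℂ) - 1 := by push_cast; ring
  rw [powQ, e2, e1]
  simp only [Q, map_add, map_mul, aeval_C, aeval_X, map_one, map_pow]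
  simp only [Complex.coe_algebraMap]
  push_cast
  ring

/-! ### Averages over vertical segments in the strip -/

/-- The average `∫_{-1}^1 f (w + i r t) ρ(t) dt`. -/
def stripInt (ρ : ℂ[X]) (f : ℂ → ℂ) (w r : ℂ) : ℂ :=
  ∫ t in (-1 : ℝ)..1, f (w + Complex.I * r * t) * ρ.eval (t : ℂ)

theorem segment_mem_strip {w r : ℂ} (h : |w.im| + ‖r‖ < 1) {t : ℝ} (ht : t ∈ Icc (-1 : ℝ) 1) :
    w + Complex.I * r * t ∈ strip := by
  have h1 : |(Complex.I * r * t).im| ≤ ‖r‖ := by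
    refine (Complex.abs_im_le_norm _).trans ?_
    rw [norm_mul, norm_mul, Complex.norm_I, one_mul, Complex.norm_real, Real.norm_eq_abs]
    exact mul_le_of_le_one_right (norm_nonneg _) (abs_le.2 ht)
  change |(w + Complex.I * r * t).im| < 1
  rw [Complex.add_im]
  linarith [abs_add_le w.im (Complex.I * r * t).im]

theorem continuousOn_stripInt_integrand {f : ℂ → ℂ} (hf : ContinuousOn f strip) (ρ : ℂ[X])
    {w r : ℂ} (h : |w.im| + ‖r‖ < 1) :
    ContinuousOn (fun t : ℝ => f (w + Complex.I * r * t) * ρ.eval (t : ℂ)) (Icc (-1) 1) :=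
  (hf.comp (by fun_prop) fun _ ht => segment_mem_strip h ht).mul (by fun_prop)

theorem intervalIntegrable_stripInt {f : ℂ → ℂ} (hf : ContinuousOn f strip) (ρ : ℂ[X])
    {w r : ℂ} (h : |w.im| + ‖r‖ < 1) :
    IntervalIntegrable (fun t : ℝ => f (w + Complex.I * r * t) * ρ.eval (t : ℂ)) volume (-1) 1 :=
  ContinuousOn.intervalIntegrable_of_Icc (by norm_num) (continuousOn_stripInt_integrand hf ρ h)

theorem stripInt_add {f : ℂ → ℂ} (hf : ContinuousOn f strip) (ρ σ : ℂ[X])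
    {w r : ℂ} (h : |w.im| + ‖r‖ < 1) :
    stripInt (ρ + σ) f w r = stripInt ρ f w r + stripInt σ f w r := by
  rw [stripInt, stripInt, stripInt, ← intervalIntegral.integral_add
    (intervalIntegrable_stripInt hf ρ h) (intervalIntegrable_stripInt hf σ h)]
  simp only [eval_add, mul_add]

theorem stripInt_C_mul (c : ℂ) (ρ : ℂ[X]) (f : ℂ → ℂ) (w r : ℂ) :
    stripInt (C c * ρ) f w r = c * stripInt ρ f w r := by
  rw [stripInt, stripInt, ← intervalIntegral.integral_const_mul]
  simp only [eval_mul, eval_C, mul_left_comm]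

theorem stripInt_zero (f : ℂ → ℂ) (w r : ℂ) : stripInt 0 f w r = 0 := by
  simp [stripInt]

/-- Integration by parts in `t`, since `d/dt f(w + irt) = ir f'(w + irt)`. -/
theorem mul_stripInt_deriv {f f' : ℂ → ℂ} (hf : ∀ z ∈ strip, HasDerivAt f (f' z) z)
    (hf' : ContinuousOn f' strip) (ρ : ℂ[X]) {w r : ℂ} (h : |w.im| + ‖r‖ < 1) :
    Complex.I * r * stripInt ρ f' w r
      = f (w + Complex.I * r) * ρ.eval 1 - f (w - Complex.I * r) * ρ.eval (-1)
        - stripInt (derivative ρ) f w r := by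
  have hc : ContinuousOn f strip := fun z hz => (hf z hz).continuousAt.continuousWithinAt
  have key : ∀ t ∈ uIcc (-1 : ℝ) 1,
      HasDerivAt (fun t : ℝ => f (w + Complex.I * r * t) * ρ.eval (t : ℂ))
        (Complex.I * r * (f' (w + Complex.I * r * t) * ρ.eval (t : ℂ))
          + f (w + Complex.I * r * t) * (derivative ρ).eval (t : ℂ)) t := by
    intro t ht
    rw [uIcc_of_le (by norm_num)] at ht
    have h1 : HasDerivAt (fun s : ℂ => w + Complex.I * r * s) (Complex.I * r) (t : ℂ) := by
      simpa using ((hasDerivAt_id (t : ℂ)).const_mul (Complex.I * r)).const_add w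
    have h2 := (hf _ (segment_mem_strip h ht)).comp (t : ℂ) h1
    have h3 := (h2.mul (ρ.hasDerivAt (t : ℂ))).comp_ofReal
    exact h3.congr_deriv (by simp only [Function.comp]; ring)
  have hi1 := (intervalIntegrable_stripInt hf' ρ h).const_mul (Complex.I * r)
  have hi2 := intervalIntegrable_stripInt hc (derivative ρ) h
  have := intervalIntegral.integral_eq_sub_of_hasDerivAt key (hi1.add hi2)
  rw [intervalIntegral.integral_add hi1 hi2, intervalIntegral.integral_const_mul] at this
  rw [stripInt, stripInt, eq_sub_iff_add_eq, this]
  push_cast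
  simp only [mul_one, mul_neg, ← sub_eq_add_neg]

/-- Differentiation under the integral sign; the derivative is bounded by its maximum on a compact
ball times `[-1, 1]`. The extra weight `X` is the factor `t` from the chain rule in `r`. -/
theorem hasFDerivAt_stripInt {f f' : ℂ → ℂ} (hf : ∀ z ∈ strip, HasDerivAt f (f' z) z)
    (hf' : ContinuousOn f' strip) (ρ : ℂ[X]) {q : ℂ × ℂ} (h : |q.1.im| + ‖q.2‖ < 1) :
    HasFDerivAt (fun q : ℂ × ℂ => stripInt ρ f q.1 q.2)
      (stripInt ρ f' q.1 q.2 • ContinuousLinearMap.fst ℂ ℂ ℂ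
        + (Complex.I * stripInt (X * ρ) f' q.1 q.2) • ContinuousLinearMap.snd ℂ ℂ ℂ) q := by
  have hc : ContinuousOn f strip := fun z hz => (hf z hz).continuousAt.continuousWithinAt
  have hD : IsOpen {q : ℂ × ℂ | |q.1.im| + ‖q.2‖ < 1} :=
    isOpen_lt (by fun_prop) continuous_const
  obtain ⟨ε, hε, hball⟩ := Metric.nhds_basis_closedBall.mem_iff.1 (hD.mem_nhds h)
  set s := Metric.closedBall q ε
  let F' : ℂ × ℂ → ℝ → (ℂ × ℂ →L[ℂ] ℂ) := fun q t =>
    (f' (q.1 + Complex.I * q.2 * t) * ρ.eval (t : ℂ)) • ContinuousLinearMap.fst ℂ ℂ ℂ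
      + (Complex.I * (f' (q.1 + Complex.I * q.2 * t) * (X * ρ).eval (t : ℂ)))
        • ContinuousLinearMap.snd ℂ ℂ ℂ
  have hF'c : ContinuousOn (fun p : (ℂ × ℂ) × ℝ => F' p.1 p.2) (s ×ˢ Icc (-1) 1) := by
    have h1 : ContinuousOn (fun p : (ℂ × ℂ) × ℝ => f' (p.1.1 + Complex.I * p.1.2 * p.2))
        (s ×ˢ Icc (-1) 1) :=
      hf'.comp (by fun_prop) fun p hp => segment_mem_strip (hball hp.1) hp.2
    exact ((h1.mul (by fun_prop)).smul continuousOn_const).add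
      ((continuousOn_const.mul (h1.mul (by fun_prop))).smul continuousOn_const)
  obtain ⟨B, hB⟩ := ((isCompact_closedBall q ε).prod isCompact_Icc).exists_bound_of_continuousOn hF'c
  have hIoc : ∀ t ∈ uIoc (-1 : ℝ) 1, t ∈ Icc (-1 : ℝ) 1 := fun t ht => by
    rw [uIoc_of_le (by norm_num)] at ht
    exact Ioc_subset_Icc_self ht
  have hF'q : ContinuousOn (F' q) (Icc (-1) 1) :=
    hF'c.comp (f := fun t => (q, t)) (by fun_prop)
      fun t ht => ⟨Metric.mem_closedBall_self hε.le, ht⟩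
  have main := intervalIntegral.hasFDerivAt_integral_of_dominated_of_fderiv_le (𝕜 := ℂ)
    (μ := volume) (a := -1) (b := 1) (bound := fun _ => B) (s := s) (x₀ := q) (F' := F')
    (F := fun q t => f (q.1 + Complex.I * q.2 * t) * ρ.eval (t : ℂ))
    (Metric.closedBall_mem_nhds q hε)
    (by
      filter_upwards [Metric.closedBall_mem_nhds q hε] with p hp
      exact (intervalIntegrable_stripInt hc ρ (hball hp)).def'.aestronglyMeasurable)
    (intervalIntegrable_stripInt hc ρ h)
    (by
      exact (hF'q.intervalIntegrable_of_Icc (by norm_num)).def'.aestronglyMeasurable)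
    (Eventually.of_forall fun t ht p hp => hB (p, t) ⟨hp, hIoc t ht⟩)
    intervalIntegrable_const
    (Eventually.of_forall fun t ht p hp => by
      have h1 : HasFDerivAt (fun q : ℂ × ℂ => q.1 + Complex.I * q.2 * t)
          (ContinuousLinearMap.fst ℂ ℂ ℂ + (Complex.I * t) • ContinuousLinearMap.snd ℂ ℂ ℂ) p := by
        have := (hasFDerivAt_fst (𝕜 := ℂ) (p := p)).add
          ((hasFDerivAt_snd (𝕜 := ℂ) (p := p)).const_smul (Complex.I * t))
        refine this.congr_of_eventuallyEq (Eventually.of_forall fun x => ?_)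
        simp; ring
      have h2 := ((hf _ (segment_mem_strip (hball hp) (hIoc t ht))).comp_hasFDerivAt p h1).mul_const
        (ρ.eval (t : ℂ))
      refine h2.congr_fderiv ?_
      ext <;> simp [F'] <;> ring)
  refine main.congr_fderiv ?_
  have i1 := intervalIntegrable_stripInt hf' ρ h
  have i2 := (intervalIntegrable_stripInt hf' (X * ρ) h).const_mul Complex.I
  have e1 : IntervalIntegrable (fun t : ℝ => (f' (q.1 + Complex.I * q.2 * t) * ρ.eval (t : ℂ)) •
      ContinuousLinearMap.fst ℂ ℂ ℂ) volume (-1) 1 := ⟨i1.1.smul_const _, i1.2.smul_const _⟩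
  have e2 : IntervalIntegrable (fun t : ℝ => (Complex.I * (f' (q.1 + Complex.I * q.2 * t) *
      (X * ρ).eval (t : ℂ))) • ContinuousLinearMap.snd ℂ ℂ ℂ) volume (-1) 1 := ⟨i2.1.smul_const _, i2.2.smul_const _⟩
  simp only [F']
  rw [intervalIntegral.integral_add e1 e2, intervalIntegral.integral_smul_const,
    intervalIntegral.integral_smul_const, intervalIntegral.integral_const_mul]
  rfl

/-! ### The integrals with weight `(1 - t²)^M` -/

/-- The weight `(1 - t²)^M`. -/
def wt (M : ℕ) : ℂ[X] := (1 - X ^ 2) ^ M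

theorem wt_succ_eq (M : ℕ) : wt (M + 1) = wt M - X ^ 2 * wt M := by
  simp only [wt]; ring

theorem derivative_wt_succ (M : ℕ) :
    derivative (wt (M + 1)) = C (-(2 * (M + 1)) : ℂ) * (X * wt M) := by
  simp only [wt, derivative_pow, derivative_sub, derivative_one, derivative_X, map_neg, map_mul,
    map_add, map_natCast, map_one, C_ofNat]
  push_cast
  simp
  ring

/-- `∫_{-1}^1 h^{(n)} (w + i r t) (1 - t²)^M dt` for `h(z) = (1 + z²)^β`. -/
def axInt (β : ℝ) (M n : ℕ) (w r : ℂ) : ℂ := stripInt (wt M) (powQ β n) w r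

theorem continuousOn_powQ (β : ℝ) (n : ℕ) : ContinuousOn (powQ β n) strip :=
  fun _ hz => (hasDerivAt_powQ β n hz).continuousAt.continuousWithinAt

/-- `t (1 - t²)^M` is a multiple of the derivative of `(1 - t²)^{M+1}`, which vanishes at `±1`, so
no boundary term appears. -/
theorem stripInt_X_mul_wt (β : ℝ) (M n : ℕ) {w r : ℂ} (h : |w.im| + ‖r‖ < 1) :
    2 * (M + 1) * stripInt (X * wt M) (powQ β n) w r
      = Complex.I * r * axInt β (M + 1) (n + 1) w r := by
  have := mul_stripInt_deriv (fun z hz => hasDerivAt_powQ β n hz) (continuousOn_powQ β (n + 1))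
    (wt (M + 1)) h
  rw [axInt, this, derivative_wt_succ, stripInt_C_mul]
  simp [wt]

/-- Two integrations by parts, the second against `t (1 - t²)^{M+1}`, whose derivative is again a
combination of the weights `M + 1` and `M`. This recurrence is what makes the `P` component of the
Cauchy–Riemann equation hold. -/
theorem axInt_recurrence (β : ℝ) (M n : ℕ) {w r : ℂ} (h : |w.im| + ‖r‖ < 1) :
    r ^ 2 * axInt β (M + 2) (n + 2) w r
      = 2 * (M + 2) * ((2 * M + 3) * axInt β (M + 1) n w r - 2 * (M + 1) * axInt β M n w r) := by
  have h1 := mul_stripInt_deriv (fun z hz => hasDerivAt_powQ β n hz) (continuousOn_powQ β (n + 1))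
    (X * wt (M + 1)) h
  have h2 := stripInt_X_mul_wt β (M + 1) (n + 1) h
  have h3 : derivative (X * wt (M + 1))
      = C (2 * M + 3 : ℂ) * wt (M + 1) + C (-(2 * (M + 1)) : ℂ) * wt M := by
    rw [derivative_mul, derivative_wt_succ, derivative_X, one_mul, wt_succ_eq]
    simp only [map_neg, map_mul, map_add, map_natCast, map_one, C_ofNat]
    ring
  rw [h3, stripInt_add (continuousOn_powQ β n) _ _ h, stripInt_C_mul, stripInt_C_mul] at h1
  simp only [eval_mul, eval_X, wt, eval_pow, eval_sub, eval_one, one_pow, sub_self,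
    zero_pow (Nat.succ_ne_zero M), mul_zero, zero_sub, even_two, Even.neg_pow] at h1
  change _ = -(_ * axInt β (M + 1) n w r + _ * axInt β M n w r) at h1
  change Complex.I * r * stripInt (X * wt (M + 1)) (powQ β (n + 1)) w r = _ at h1
  have hI : Complex.I * Complex.I = -1 := Complex.I_mul_I
  push_cast at h2
  linear_combination (Complex.I * r) * h2 - (2 * (M + 2)) * h1
    + r ^ 2 * axInt β (M + 2) (n + 2) w r * hI

/-- Rewriting the `r`-derivative through the weight `M + 1` exposes a factor `r`, which later gives
differentiability in `x` at the origin, where `r = |x|` is not smooth. -/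
theorem hasFDerivAt_axInt (β : ℝ) (M n : ℕ) {q : ℂ × ℂ} (h : |q.1.im| + ‖q.2‖ < 1) :
    HasFDerivAt (fun q : ℂ × ℂ => axInt β M n q.1 q.2)
      (axInt β M (n + 1) q.1 q.2 • ContinuousLinearMap.fst ℂ ℂ ℂ
        + (-q.2 / (2 * (M + 1)) * axInt β (M + 1) (n + 2) q.1 q.2) •
          ContinuousLinearMap.snd ℂ ℂ ℂ) q := by
  refine (hasFDerivAt_stripInt (fun z hz => hasDerivAt_powQ β n hz) (continuousOn_powQ β (n + 1))
    (wt M) h).congr_fderiv ?_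
  have h2 := stripInt_X_mul_wt β M (n + 1) h
  have h3 : (2 * (M + 1) : ℂ) ≠ 0 := by exact_mod_cast (by positivity : 2 * (M + 1) ≠ 0)
  congr 2
  have hI : Complex.I * Complex.I = -1 := Complex.I_mul_I
  field_simp
  linear_combination Complex.I * h2 + q.2 * axInt β (M + 1) (n + 2) q.1 q.2 * hI

theorem hasDerivAt_axInt_left (β : ℝ) (M n : ℕ) {w r : ℂ} (h : |w.im| + ‖r‖ < 1) :
    HasDerivAt (fun w => axInt β M n w r) (axInt β M (n + 1) w r) w := by
  have h1 : HasDerivAt (fun w : ℂ => (w, r)) (1, 0) w :=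
    (hasDerivAt_id w).prodMk (hasDerivAt_const w r)
  have := (hasFDerivAt_axInt β M n (q := (w, r)) h).comp_hasDerivAt w h1
  exact this.congr_deriv (by simp)

theorem hasDerivAt_axInt_right (β : ℝ) (M n : ℕ) {w r : ℂ} (h : |w.im| + ‖r‖ < 1) :
    HasDerivAt (fun r => axInt β M n w r) (-r / (2 * (M + 1)) * axInt β (M + 1) (n + 2) w r) r := by
  have h1 : HasDerivAt (fun r : ℂ => (w, r)) (0, 1) r :=
    (hasDerivAt_const r w).prodMk (hasDerivAt_id r)
  have := (hasFDerivAt_axInt β M n (q := (w, r)) h).comp_hasDerivAt r h1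
  exact this.congr_deriv (by simp)

/-! ### Values at `x₀ = 0` -/

/-- Induction on `M`: since `∂_r` sends `(M, n)` to `(M + 1, n + 2)` up to the factor `-r/(2(M+1))`,
differentiating the formula for `M` gives the one for `M + 1`. For `M = 0` the integral of `h''` is
a difference of values of `h'`. -/
theorem axInt_zero_left (β : ℝ) (M : ℕ) {r : ℂ} (hr : ‖r‖ < 1) :
    axInt β M (2 * M + 2) 0 r
      = 4 ^ (M + 1) * (M ! : ℂ) * (∏ j ∈ Finset.range (M + 1), ((β : ℂ) - j))
        * (1 - r ^ 2) ^ ((β - (M + 1 : ℕ) : ℝ) : ℂ) := by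
  have hstrip : ∀ r : ℂ, ‖r‖ < 1 → Complex.I * r ∈ strip := fun r hr => by
    have := segment_mem_strip (w := 0) (r := r) (by simpa using hr) (t := 1) (by simp)
    simpa using this
  have hslit : ∀ r : ℂ, ‖r‖ < 1 → 1 - r ^ 2 ∈ Complex.slitPlane := fun r hr => by
    have := one_add_sq_mem_slitPlane (hstrip r hr)
    rwa [mul_pow, Complex.I_sq, neg_one_mul, ← sub_eq_add_neg] at this
  have hcontL : ∀ M n, ∀ r : ℂ, ‖r‖ < 1 → ContinuousAt (fun r => axInt β M n 0 r) r :=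
    fun M n r hr => (hasDerivAt_axInt_right β M n (by simpa using hr)).continuousAt
  have hderR : ∀ c : ℂ, ∀ r : ℂ, ‖r‖ < 1 → HasDerivAt (fun r : ℂ => (1 - r ^ 2) ^ c)
      (-2 * r * c * (1 - r ^ 2) ^ (c - 1)) r := fun c r hr => by
    have h1 : HasDerivAt (fun z : ℂ => 1 - z ^ 2) (-(2 * r)) r := by
      simpa using (hasDerivAt_pow 2 r).const_sub 1
    exact (h1.cpow_const (hslit r hr)).congr_deriv (by ring)
  have hball : ∀ r : ℂ, ‖r‖ < 1 → ∀ᶠ s in 𝓝 r, ‖s‖ < 1 := fun r hr =>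
    (isOpen_lt continuous_norm continuous_const).mem_nhds hr
  -- Both the base case and the inductive step divide by `r`; the value at `r = 0` follows by
  -- continuity.
  suffices hne : ∀ M : ℕ, ∀ r : ℂ, ‖r‖ < 1 → r ≠ 0 → axInt β M (2 * M + 2) 0 r
      = 4 ^ (M + 1) * (M ! : ℂ) * (∏ j ∈ Finset.range (M + 1), ((β : ℂ) - j))
        * (1 - r ^ 2) ^ ((β - (M + 1 : ℕ) : ℝ) : ℂ) by
    by_cases h0 : r = 0
    · subst h0
      have t1 := (hcontL M (2 * M + 2) 0 (by simp)).tendsto.mono_left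
        (nhdsWithin_le_nhds (s := {0}ᶜ))
      have t2 := ((hderR ((β - (M + 1 : ℕ) : ℝ) : ℂ) 0 (by simp)).continuousAt.tendsto.const_mul
        (4 ^ (M + 1) * (M ! : ℂ) * (∏ j ∈ Finset.range (M + 1), ((β : ℂ) - j)))).mono_left
        (nhdsWithin_le_nhds (s := {0}ᶜ))
      refine tendsto_nhds_unique (t1.congr' ?_) t2
      filter_upwards [self_mem_nhdsWithin, nhdsWithin_le_nhds (hball 0 (by simp))] with s h1 h2
      exact hne M s h2 h1
    · exact hne M r hr h0
  intro M
  induction M with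
  | zero =>
    intro r hr h0
    have h1 := mul_stripInt_deriv (fun z hz => hasDerivAt_powQ β 1 hz) (continuousOn_powQ β 2)
      (wt 0) (w := 0) (r := r) (by simpa using hr)
    have h2 : (1 + (Complex.I * r) ^ 2) = 1 - r ^ 2 := by rw [mul_pow, Complex.I_sq]; ring
    have h3 : (1 + (-(Complex.I * r)) ^ 2) = 1 - r ^ 2 := by rw [neg_sq, h2]
    have hq : ∀ z, powQ β 1 z = (1 + z ^ 2) ^ ((β - (1 : ℕ) : ℝ) : ℂ) * (2 * β * z) := fun z => by
      simp [powQ, Q]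
    simp only [wt, pow_zero, derivative_one, stripInt_zero, eval_one, zero_add, zero_sub, mul_one,
      sub_zero, hq, h2, h3] at h1
    have h4 : axInt β 0 2 0 r = stripInt 1 (powQ β 2) 0 r := by simp [axInt, wt]
    have h5 : Complex.I * r ≠ 0 := mul_ne_zero Complex.I_ne_zero h0
    apply mul_left_cancel₀ h5
    simp only [mul_zero, zero_add, h4, Finset.range_one, Finset.prod_singleton, Nat.factorial_zero]
    rw [h1]
    push_cast
    ring
  | succ M ih =>
    intro r hr h0
    have d1 := hasDerivAt_axInt_right β M (2 * M + 2) (w := 0) (r := r) (by simpa using hr)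
    have d2 := (hderR ((β - (M + 1 : ℕ) : ℝ) : ℂ) r hr).const_mul
      (4 ^ (M + 1) * (M ! : ℂ) * (∏ j ∈ Finset.range (M + 1), ((β : ℂ) - j)))
    have d3 : (fun r => axInt β M (2 * M + 2) 0 r) =ᶠ[𝓝 r] fun r =>
        4 ^ (M + 1) * (M ! : ℂ) * (∏ j ∈ Finset.range (M + 1), ((β : ℂ) - j))
        * (1 - r ^ 2) ^ ((β - (M + 1 : ℕ) : ℝ) : ℂ) := by
      filter_upwards [hball r hr, isOpen_ne.mem_nhds h0] with s h1 h2
      exact ih s h1 h2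
    have d4 := d1.unique (d2.congr_of_eventuallyEq d3)
    have e1 : ((β - (M + 1 : ℕ) : ℝ) : ℂ) - 1 = ((β - (M + 1 + 1 : ℕ) : ℝ) : ℂ) := by
      push_cast; ring
    rw [e1] at d4
    have h3 : (2 * (M + 1) : ℂ) ≠ 0 := by exact_mod_cast (by positivity : 2 * (M + 1) ≠ 0)
    have h4 : -r / (2 * (M + 1)) ≠ 0 := div_ne_zero (neg_ne_zero.2 h0) h3
    apply mul_left_cancel₀ h4
    rw [show 2 * (M + 1) + 2 = 2 * M + 2 + 2 by ring, d4, Finset.prod_range_succ _ (M + 1),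
      Nat.factorial_succ]
    have h5 : (M + 1 : ℂ) ≠ 0 := by exact_mod_cast Nat.succ_ne_zero M
    push_cast
    field_simp
    ring

/-! ### Taylor expansion in `x₀` -/

/-- The integral is holomorphic in `w` on the disc of radius `1 - ‖r‖`, and each `w`-derivative
raises `n` by one. -/
theorem hasSum_axInt (β : ℝ) (M n : ℕ) {w r : ℂ} (h : ‖w‖ + ‖r‖ < 1) :
    HasSum (fun l : ℕ => w ^ l / (l ! : ℂ) * axInt β M (n + l) 0 r) (axInt β M n w r) := by
  have hmem : ∀ z ∈ Metric.ball (0 : ℂ) (1 - ‖r‖), |z.im| + ‖r‖ < 1 := fun z hz => by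
    rw [mem_ball_zero_iff] at hz
    linarith [Complex.abs_im_le_norm z]
  have hd : DifferentiableOn ℂ (fun w => axInt β M n w r) (Metric.ball 0 (1 - ‖r‖)) := fun z hz =>
    (hasDerivAt_axInt_left β M n (hmem z hz)).differentiableAt.differentiableWithinAt
  have hw : w ∈ Metric.ball (0 : ℂ) (1 - ‖r‖) := by
    rw [mem_ball_zero_iff]; linarith
  have hit : ∀ l : ℕ, ∀ z ∈ Metric.ball (0 : ℂ) (1 - ‖r‖),
      iteratedDeriv l (fun w => axInt β M n w r) z = axInt β M (n + l) z r := by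
    intro l
    induction l with
    | zero => intro z _; simp
    | succ l ih =>
      intro z hz
      have : iteratedDeriv l (fun w => axInt β M n w r) =ᶠ[𝓝 z] fun w => axInt β M (n + l) w r := by
        filter_upwards [Metric.isOpen_ball.mem_nhds hz] with s hs using ih s hs
      rw [iteratedDeriv_succ, this.deriv_eq, (hasDerivAt_axInt_left β M (n + l) (hmem z hz)).deriv]
      rfl
  have hsum := Complex.hasSum_taylorSeries_on_ball hd hw
  have e : (fun l : ℕ => w ^ l / (l ! : ℂ) * axInt β M (n + l) 0 r) = fun l : ℕ =>
      (l ! : ℂ)⁻¹ • (w - 0) ^ l • iteratedDeriv l (fun w => axInt β M n w r) 0 := by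
    funext l
    rw [hit l 0 (by rw [mem_ball_zero_iff, norm_zero]; linarith [norm_nonneg w]), smul_eq_mul,
      smul_eq_mul, sub_zero]
    ring
  rw [e]
  exact hsum

/-! ### The closed form -/

/-- `d + 1` integrations by parts move all derivatives onto `ρ`, after which the remaining integral
is zero. -/
theorem stripInt_eq_sum (β : ℝ) (s d : ℕ) (ρ : ℂ[X]) (hρ : derivative^[d + 1] ρ = 0)
    {w r : ℂ} (h : |w.im| + ‖r‖ < 1) (hr : r ≠ 0) :
    stripInt ρ (powQ β (s + d + 1)) w r = ∑ j ∈ Finset.range (d + 1),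
      (-1) ^ j / (Complex.I * r) ^ (j + 1) *
        (powQ β (s + d - j) (w + Complex.I * r) * (derivative^[j] ρ).eval 1
          - powQ β (s + d - j) (w - Complex.I * r) * (derivative^[j] ρ).eval (-1)) := by
  have hI : Complex.I * r ≠ 0 := mul_ne_zero Complex.I_ne_zero hr
  induction d generalizing ρ with
  | zero =>
    have h1 := mul_stripInt_deriv (fun z hz => hasDerivAt_powQ β s hz)
      (continuousOn_powQ β (s + 1)) ρ h
    simp only [zero_add, Function.iterate_one] at hρ
    rw [hρ, stripInt_zero, sub_zero] at h1
    rw [zero_add, Finset.sum_range_one]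
    simp only [pow_zero, zero_add, pow_one, Nat.sub_zero, Function.iterate_zero, id_eq, add_zero]
    rw [← h1]
    field_simp
  | succ d ih =>
    have h1 := mul_stripInt_deriv (fun z hz => hasDerivAt_powQ β (s + d + 1) hz)
      (continuousOn_powQ β (s + d + 1 + 1)) ρ h
    rw [ih (derivative ρ) (by rwa [← Function.iterate_succ_apply])] at h1
    apply mul_left_cancel₀ hI
    rw [← add_assoc s d 1, h1, Finset.sum_range_succ' _ (d + 1), mul_add, Finset.mul_sum, sub_eq_add_neg,
      add_comm, ← Finset.sum_neg_distrib]
    congr 1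
    · refine Finset.sum_congr rfl fun j _ => ?_
      rw [← Function.iterate_succ_apply, show s + d + 1 - (j + 1) = s + d - j by omega, pow_succ,
        pow_succ _ (j + 1)]
      field_simp
      ring
    · simp only [pow_zero, zero_add, pow_one, Nat.sub_zero, Function.iterate_zero, id_eq]
      field_simp

theorem taylor_wt (M : ℕ) {c : ℂ} (hc : c ^ 2 = 1) :
    taylor c (wt M) = C ((-1) ^ M) * (X ^ M * (X + C (2 * c)) ^ M) := by
  have : (1 : ℂ[X]) - (X + C c) ^ 2 = C (-1) * (X * (X + C (2 * c))) := by
    have h1 : (C c : ℂ[X]) ^ 2 = 1 := by rw [← C_pow, hc, C_1]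
    simp only [map_neg, C_1, map_mul, C_ofNat]
    linear_combination -h1
  rw [wt, taylor_pow, map_sub, taylor_one, taylor_pow, taylor_X, C_1, this, mul_pow, mul_pow, C_pow]

theorem eval_iterate_derivative (ρ : ℂ[X]) (j : ℕ) (c : ℂ) :
    (derivative^[j] ρ).eval c = (j ! : ℂ) * (taylor c ρ).coeff j := by
  rw [taylor_coeff, ← Polynomial.factorial_smul_hasseDeriv]
  simp

theorem eval_iterate_derivative_wt (M n : ℕ) (hn : n ≤ M) {c : ℂ} (hc : c ^ 2 = 1) :
    (derivative^[2 * M - n] (wt M)).eval c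
      = (-1) ^ M * ((2 * M - n)! : ℂ) * (M.choose n : ℂ) * (2 * c) ^ n := by
  rw [eval_iterate_derivative, taylor_wt M hc, coeff_C_mul,
    show 2 * M - n = (M - n) + M by omega, coeff_X_pow_mul, coeff_X_add_C_pow,
    Nat.choose_symm hn, Nat.sub_sub_self hn]
  ring

theorem eval_iterate_derivative_wt_of_lt (M j : ℕ) (hj : j < M) {c : ℂ} (hc : c ^ 2 = 1) :
    (derivative^[j] (wt M)).eval c = 0 := by
  rw [eval_iterate_derivative, taylor_wt M hc, coeff_C_mul, coeff_X_pow_mul', if_neg (by omega)]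
  simp

theorem iterate_derivative_wt_eq_zero (M : ℕ) : derivative^[2 * M + 1] (wt M) = 0 := by
  apply iterate_derivative_eq_zero
  refine lt_of_le_of_lt (natDegree_pow_le (n := M)) ?_
  have : (1 - X ^ 2 : ℂ[X]).natDegree ≤ 2 := by compute_degree
  nlinarith

/-- The weight vanishes to order `M` at `±1`, so of the `2M + 1` boundary terms only those with at
least `M` derivatives on the weight survive; `n` counts down from `2M`. -/
theorem axInt_eq_sum (β : ℝ) (s M : ℕ) {w r : ℂ} (h : |w.im| + ‖r‖ < 1) (hr : r ≠ 0) :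
    axInt β M (s + 2 * M + 1) w r = ∑ n ∈ Finset.range (M + 1),
      ((2 * M - n)! : ℂ) * (M.choose n : ℂ) * 2 ^ n * (-Complex.I) ^ (n + 1) / r ^ (2 * M + 1 - n) *
        (powQ β (s + n) (w + Complex.I * r)
          + (-1) ^ (n + 1) * powQ β (s + n) (w - Complex.I * r)) := by
  rw [axInt, stripInt_eq_sum β s (2 * M) (wt M) (iterate_derivative_wt_eq_zero M) h hr,
    ← Finset.sum_range_reflect]
  symm
  refine Finset.sum_subset_zero_on_sdiff (Finset.range_subset_range.2 (by omega)) ?_ ?_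
  · intro n hn
    simp only [Finset.mem_sdiff, Finset.mem_range] at hn
    rw [eval_iterate_derivative_wt_of_lt M _ (by omega) (one_pow 2),
      eval_iterate_derivative_wt_of_lt M _ (by omega) (by norm_num)]
    ring
  · intro n hn
    have hn' : n ≤ M := Nat.lt_succ_iff.1 (Finset.mem_range.1 hn)
    obtain ⟨l, rfl⟩ := Nat.exists_eq_add_of_le hn'
    rw [show 2 * (n + l) + 1 - 1 - n = 2 * (n + l) - n by omega,
      eval_iterate_derivative_wt _ n hn' (one_pow 2),
      eval_iterate_derivative_wt _ n hn' (by norm_num : (-1 : ℂ) ^ 2 = 1),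
      show s + 2 * (n + l) - (2 * (n + l) - n) = s + n by omega,
      show 2 * (n + l) - n = n + 2 * l by omega,
      show 2 * (n + l) + 1 - n = n + 2 * l + 1 by omega]
    -- With `M = n + l`, the signs `(-1)^{2M-n}` and `(-1)^M` multiply to `(-1)^l`, which turns the
    -- power of `1/I` into the power of `-I`.
    have hI : (-Complex.I) ^ (n + 1) = (-1) ^ l / Complex.I ^ (n + 2 * l + 1) := by
      rw [eq_div_iff (pow_ne_zero _ Complex.I_ne_zero),
        show n + 2 * l + 1 = (n + 1) + 2 * l by ring, pow_add Complex.I, ← mul_assoc, ← mul_pow, pow_mul,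
        Complex.I_sq, neg_mul, Complex.I_mul_I, neg_neg, one_pow, one_mul]
    have h1 : ((-1 : ℂ) ^ n) ^ 2 = 1 := by rw [← pow_mul, mul_comm, pow_mul]; simp
    have h2 : ((-1 : ℂ) ^ l) ^ 2 = 1 := by rw [← pow_mul, mul_comm, pow_mul]; simp
    rw [hI, mul_pow Complex.I r, mul_pow 2 (-1 : ℂ), pow_add (-1 : ℂ) n (2 * l), pow_mul, neg_one_sq,
      one_pow, pow_add (-1 : ℂ) n l, pow_succ (-1 : ℂ) n]
    generalize (-1 : ℂ) ^ n = ε at *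
    generalize (-1 : ℂ) ^ l = δ at *
    generalize Complex.I ^ (n + 2 * l + 1) = u at *
    simp only [div_eq_mul_inv, mul_inv]
    linear_combination (-(((n + 2 * l)! : ℂ) * ((n + l).choose n : ℂ) * 2 ^ n * δ * u⁻¹
      * (r ^ (n + 2 * l + 1))⁻¹ * (powQ β (s + n) (w + Complex.I * r)
        - ε * powQ β (s + n) (w - Complex.I * r)))) * h1

theorem powQ_conj (β : ℝ) (n : ℕ) {z : ℂ} (hz : z ∈ strip) :
    powQ β n (starRingEnd ℂ z) = starRingEnd ℂ (powQ β n z) := by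
  have h1 : (1 + z ^ 2).arg ≠ Real.pi := Complex.slitPlane_arg_ne_pi (one_add_sq_mem_slitPlane hz)
  rw [powQ, powQ, map_mul, aeval_conj, ← map_pow, ← map_one (starRingEnd ℂ), ← map_add,
    Complex.conj_cpow _ _ h1, Complex.conj_ofReal, map_one]

/-- Conjugating the integrand at `t` gives the integrand at `-t`, because the weight is even and `w`
is real. -/
theorem axInt_re (β : ℝ) (M n : ℕ) (x r : ℝ) (hr : |r| < 1) :
    ((axInt β M n x r).re : ℂ) = axInt β M n x r := by
  rw [← Complex.conj_eq_iff_re]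
  have h : |(x : ℂ).im| + ‖(r : ℂ)‖ < 1 := by simpa using hr
  rw [axInt, stripInt, intervalIntegral.integral_of_le (by norm_num), ← integral_conj,
    ← intervalIntegral.integral_of_le (by norm_num), ← intervalIntegral.integral_of_le (by norm_num)]
  have e : ∫ t in (-1 : ℝ)..1, powQ β n (x + Complex.I * r * t) * (wt M).eval (t : ℂ)
      = ∫ t in (-1 : ℝ)..1, powQ β n (x + Complex.I * r * (-t : ℝ)) * (wt M).eval ((-t : ℝ) : ℂ) := by
    rw [intervalIntegral.integral_comp_neg
      (fun t : ℝ => powQ β n (x + Complex.I * r * t) * (wt M).eval (t : ℂ)), neg_neg]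
  rw [e]
  refine intervalIntegral.integral_congr fun t ht => ?_
  rw [uIcc_of_le (by norm_num)] at ht
  simp only [map_mul]
  rw [← powQ_conj β n (segment_mem_strip h ht)]
  congr 1
  · congr 1
    simp
  · simp [wt]

/-- `axInt_eq_sum` with `s = 1`, which is why the sum for `A` starts at `n = 1`. With `M = n + l`
after the shift, the double factorial is `(2l)‼ = 2^l l!`, and a binomial coefficient appears. -/
theorem sumA_eq {m k q M : ℕ} (hm : m = 2 * q + 1) (hM : k + q = M + 1) (α x r : ℝ)
    (hr0 : 0 < r) (hr : r < 1) :
    2 ^ M * (M ! : ℂ) * sumA m k α x r = axInt (α + (M + 1 : ℕ)) M (2 * M + 2) x r := by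
  have hβ : α + k + ((m : ℝ) - 1) / 2 = α + (M + 1 : ℕ) := by
    rw [← hM, hm]; push_cast; ring
  have h : |(x : ℂ).im| + ‖(r : ℂ)‖ < 1 := by simpa [abs_of_pos hr0] using hr
  have hI : Finset.Icc 1 (k + (m - 1) / 2) = Finset.Ico 1 (M + 2) := by
    ext n; simp only [Finset.mem_Icc, Finset.mem_Ico]; omega
  rw [sumA, hβ, hI, Finset.sum_Ico_eq_sum_range, show 2 * M + 2 = 1 + 2 * M + 1 by ring,
    axInt_eq_sum _ 1 M h (by exact_mod_cast hr0.ne'), Finset.mul_sum]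
  simp only [show M + 2 - 1 = M + 1 by omega]
  refine Finset.sum_congr rfl fun n hn => ?_
  obtain ⟨l, rfl⟩ := Nat.exists_eq_add_of_le (Nat.lt_succ_iff.1 (Finset.mem_range.1 hn))
  have h1 : starRingEnd ℂ (x + Complex.I * r) = x - Complex.I * r := by
    simp [sub_eq_add_neg]
  rw [a, h1, show 2 * k + m - (1 + n) - 2 = 2 * (n + l) - n by omega,
    show 2 * k + m - 2 * (1 + n) - 1 = 2 * l by omega, show 1 + n - 1 = n by omega,
    show 2 * k + m - (1 + n) - 1 = 2 * (n + l) + 1 - n by omega, Nat.doubleFactorial_two_mul,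
    add_comm 1 n]
  have h2 : (((n + l).choose n : ℕ) : ℂ) * (n ! : ℂ) * (l ! : ℂ) = ((n + l)! : ℂ) := by
    rw [Nat.choose_symm_add]
    exact_mod_cast Nat.add_choose_mul_factorial_mul_factorial n l
  rw [← h2]
  have h3 : (n ! : ℂ) ≠ 0 := by exact_mod_cast Nat.factorial_ne_zero n
  have h4 : (l ! : ℂ) ≠ 0 := by exact_mod_cast Nat.factorial_ne_zero l
  push_cast
  field_simp
  ring

/-- `axInt_eq_sum` with `s = 0` and weight `M + 1`; the factor `r` corrects the power of `r` in the
denominators. -/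
theorem sumB_eq {m k q M : ℕ} (hm : m = 2 * q + 1) (hM : k + q = M + 1) (α x r : ℝ)
    (hr0 : 0 < r) (hr : r < 1) :
    2 ^ (M + 1) * ((M + 1)! : ℂ) * sumB m k α x r
      = r * axInt (α + (M + 1 : ℕ)) (M + 1) (2 * M + 3) x r := by
  have hβ : α + k + ((m : ℝ) - 1) / 2 = α + (M + 1 : ℕ) := by
    rw [← hM, hm]; push_cast; ring
  have h : |(x : ℂ).im| + ‖(r : ℂ)‖ < 1 := by simpa [abs_of_pos hr0] using hr
  have hr1 : (r : ℂ) ≠ 0 := by exact_mod_cast hr0.ne'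
  have hI : Finset.Icc 0 (k + (m - 1) / 2) = Finset.range (M + 1 + 1) := by
    ext n; simp only [Finset.mem_Icc, Finset.mem_range]; omega
  rw [sumB, hβ, hI, show 2 * M + 3 = 0 + 2 * (M + 1) + 1 by ring,
    axInt_eq_sum _ 0 (M + 1) h hr1, Finset.mul_sum, Finset.mul_sum]
  refine Finset.sum_congr rfl fun n hn => ?_
  have hn' : n ≤ M + 1 := Nat.lt_succ_iff.1 (Finset.mem_range.1 hn)
  obtain ⟨l, hl⟩ := Nat.exists_eq_add_of_le hn'
  have h1 : starRingEnd ℂ (x + Complex.I * r) = x - Complex.I * r := by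
    simp [sub_eq_add_neg]
  rw [b, h1, show 2 * k + m - n - 1 = 2 * (M + 1) - n by omega,
    show 2 * k + m - 2 * n - 1 = 2 * l by omega,
    show 2 * (M + 1) + 1 - n = (2 * (M + 1) - n) + 1 by omega, Nat.doubleFactorial_two_mul,
    zero_add, hl]
  have h2 : (((n + l).choose n : ℕ) : ℂ) * (n ! : ℂ) * (l ! : ℂ) = ((n + l)! : ℂ) := by
    rw [Nat.choose_symm_add]
    exact_mod_cast Nat.add_choose_mul_factorial_mul_factorial n l
  rw [← h2]
  have h3 : (n ! : ℂ) ≠ 0 := by exact_mod_cast Nat.factorial_ne_zero n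
  have h4 : (l ! : ℂ) ≠ 0 := by exact_mod_cast Nat.factorial_ne_zero l
  push_cast
  field_simp
  ring

/-! ### Axial functions of `(x₀, x)` -/

/-- Away from the origin `|x| d|x| = ⟨x, ·⟩`. At the origin the radial derivative `κ|x|` is zero, so
the little-o estimate for `G` transfers through `(x₀, x) ↦ (x₀, |x|)`, which preserves norms. -/
theorem hasFDerivAt_comp_norm_snd {V : Type*} [NormedAddCommGroup V] [InnerProductSpace ℝ V]
    {G : ℝ × ℝ → ℝ} {A κ : ℝ} {p : ℝ × V}
    (hG : HasFDerivAt G (A • ContinuousLinearMap.fst ℝ ℝ ℝ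
      + (κ * ‖p.2‖) • ContinuousLinearMap.snd ℝ ℝ ℝ) (p.1, ‖p.2‖)) :
    HasFDerivAt (fun p : ℝ × V => G (p.1, ‖p.2‖)) (A • ContinuousLinearMap.fst ℝ ℝ V
      + κ • (innerSL ℝ p.2).comp (ContinuousLinearMap.snd ℝ ℝ V)) p := by
  by_cases h0 : p.2 = 0
  · simp only [h0, norm_zero, mul_zero, zero_smul, add_zero, map_zero,
      ContinuousLinearMap.zero_comp, smul_zero] at hG ⊢
    rw [hasFDerivAt_iff_isLittleO_nhds_zero] at hG ⊢
    have ht : Tendsto (fun v : ℝ × V => (v.1, ‖v.2‖)) (𝓝 0) (𝓝 0) := by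
      have : Continuous fun v : ℝ × V => (v.1, ‖v.2‖) := by fun_prop
      simpa [Prod.zero_eq_mk] using this.tendsto 0
    have h1 := (hG.comp_tendsto ht).trans_le (k := fun v : ℝ × V => v) fun v => by
      simp [Prod.norm_def]
    refine h1.congr_left fun v => ?_
    simp [h0]
  · have hd : DifferentiableAt ℝ (fun y : V => ‖y‖) p.2 := differentiableAt_id.norm ℝ h0
    have h1 := (hd.hasFDerivAt.pow 2).unique (hasStrictFDerivAt_norm_sq p.2).hasFDerivAt
    have h2 : innerSL ℝ p.2 = ‖p.2‖ • fderiv ℝ (fun y : V => ‖y‖) p.2 := by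
      ext y
      have := DFunLike.congr_fun h1 y
      simp at this ⊢
      linarith
    have h3 : HasFDerivAt (fun p : ℝ × V => (p.1, ‖p.2‖)) _ p :=
      hasFDerivAt_fst.prodMk (hd.hasFDerivAt.comp p hasFDerivAt_snd)
    refine (HasFDerivAt.comp (f := fun p : ℝ × V => (p.1, ‖p.2‖)) p hG h3).congr_fderiv ?_
    rw [h2]
    ext <;> simp [mul_assoc]

variable {m : ℕ}

/-- The real function `(x₀, x) ↦ ∫_{-1}^1 h^{(n)} (x₀ + i |x| t) (1 - t²)^M dt`. -/
def axFun (β : ℝ) (M n : ℕ) (p : ℝ × E m) : ℝ := (axInt β M n p.1 ‖p.2‖).re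

theorem ofReal_axFun (β : ℝ) (M n : ℕ) {p : ℝ × E m} (hp : ‖p.2‖ < 1) :
    (axFun β M n p : ℂ) = axInt β M n p.1 ‖p.2‖ :=
  axInt_re β M n p.1 ‖p.2‖ (by rwa [abs_norm])

theorem hasFDerivAt_axFun (β : ℝ) (M n : ℕ) {p : ℝ × E m} (hp : ‖p.2‖ < 1) :
    HasFDerivAt (axFun β M n) (axFun β M (n + 1) p • ContinuousLinearMap.fst ℝ ℝ (E m)
      + (-axFun β (M + 1) (n + 2) p / (2 * (M + 1))) •
        (innerSL ℝ p.2).comp (ContinuousLinearMap.snd ℝ ℝ (E m))) p := by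
  have hq : |((p.1 : ℂ)).im| + ‖((‖p.2‖ : ℝ) : ℂ)‖ < 1 := by simpa using hp
  have h1 := (hasFDerivAt_axInt β M n (q := ((p.1 : ℂ), ((‖p.2‖ : ℝ) : ℂ))) hq).restrictScalars ℝ
  have h2 : HasFDerivAt (fun s : ℝ × ℝ => ((s.1 : ℂ), (s.2 : ℂ)))
      ((Complex.ofRealCLM.comp (ContinuousLinearMap.fst ℝ ℝ ℝ)).prod
        (Complex.ofRealCLM.comp (ContinuousLinearMap.snd ℝ ℝ ℝ))) (p.1, ‖p.2‖) :=
    ((Complex.ofRealCLM.comp (ContinuousLinearMap.fst ℝ ℝ ℝ)).prod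
        (Complex.ofRealCLM.comp (ContinuousLinearMap.snd ℝ ℝ ℝ))).hasFDerivAt
  have h3 := Complex.reCLM.hasFDerivAt.comp _ (HasFDerivAt.comp (p.1, ‖p.2‖) h1 h2)
  refine hasFDerivAt_comp_norm_snd (G := fun s : ℝ × ℝ => (axInt β M n s.1 s.2).re)
    (h3.congr_fderiv ?_)
  simp only [← ofReal_axFun β _ _ hp]
  have e : -((‖p.2‖ : ℝ) : ℂ) / (2 * (M + 1)) * (axFun β (M + 1) (n + 2) p : ℂ)
      = ((-axFun β (M + 1) (n + 2) p / (2 * (M + 1)) * ‖p.2‖ : ℝ) : ℂ) := by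
    push_cast; ring
  rw [e]
  generalize -axFun β (M + 1) (n + 2) p / (2 * (M + 1)) * ‖p.2‖ = c
  ext <;> simp

theorem continuousOn_axFun (β : ℝ) (M n : ℕ) :
    ContinuousOn (axFun β M n : ℝ × E m → ℝ) {p | ‖p.2‖ < 1} :=
  fun _ hp => (hasFDerivAt_axFun β M n hp).continuousAt.continuousWithinAt

theorem axFun_recurrence (β : ℝ) (M n : ℕ) {p : ℝ × E m} (hp : ‖p.2‖ < 1) :
    ‖p.2‖ ^ 2 * axFun β (M + 2) (n + 2) p
      = 2 * (M + 2) * ((2 * M + 3) * axFun β (M + 1) n p - 2 * (M + 1) * axFun β M n p) := by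
  have hq : |((p.1 : ℂ)).im| + ‖((‖p.2‖ : ℝ) : ℂ)‖ < 1 := by simpa using hp
  have := axInt_recurrence β M n hq
  simp only [← ofReal_axFun β _ _ hp] at this
  exact_mod_cast this

theorem axFun_zero_left (β : ℝ) (M : ℕ) {x : E m} (hx : ‖x‖ < 1) :
    axFun β M (2 * M + 2) (0, x) = 4 ^ (M + 1) * (M ! : ℝ) *
      (∏ j ∈ Finset.range (M + 1), (β - j)) * (1 - ‖x‖ ^ 2) ^ (β - (M + 1 : ℕ)) := by
  have h := axInt_zero_left β M (r := ((‖x‖ : ℝ) : ℂ)) (by simpa using hx)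
  have h0 : (0 : ℝ) ≤ 1 - ‖x‖ ^ 2 := by nlinarith [norm_nonneg x]
  have h1 := ofReal_axFun β M (2 * M + 2) (p := (0, x)) hx
  simp only [Complex.ofReal_zero] at h1
  rw [← h1, show (1 - ((‖x‖ : ℝ) : ℂ) ^ 2) = ((1 - ‖x‖ ^ 2 : ℝ) : ℂ) by push_cast; ring,
    ← Complex.ofReal_cpow h0] at h
  exact_mod_cast h

theorem hasSum_axFun (β : ℝ) (M n : ℕ) {p : ℝ × E m} (hp : |p.1| + ‖p.2‖ < 1) :
    HasSum (fun l : ℕ => p.1 ^ l / (l ! : ℝ) * axFun β M (n + l) (0, p.2)) (axFun β M n p) := by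
  have h := hasSum_axInt β M n (w := (p.1 : ℂ)) (r := ((‖p.2‖ : ℝ) : ℂ)) (by simpa using hp)
  have hx : ‖p.2‖ < 1 := by linarith [abs_nonneg p.1]
  rw [← ofReal_axFun β M n hx] at h
  have e : (fun l : ℕ => (p.1 : ℂ) ^ l / (l ! : ℂ) * axInt β M (n + l) 0 (‖p.2‖ : ℝ))
      = fun l : ℕ => ((p.1 ^ l / (l ! : ℝ) * axFun β M (n + l) (0, p.2) : ℝ) : ℂ) := by
    funext l
    have := ofReal_axFun β M (n + l) (p := (0, p.2)) hx
    push_cast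
    rw [this]
    simp
  rw [e] at h
  exact Complex.hasSum_ofReal.1 h

theorem contDiffOn_axFun (β : ℝ) (M n : ℕ) :
    ContDiffOn ℝ 1 (axFun β M n : ℝ × E m → ℝ) {p | ‖p.2‖ < 1} := by
  have hΩ : IsOpen {p : ℝ × E m | ‖p.2‖ < 1} := isOpen_lt (by fun_prop) continuous_const
  rw [show (1 : WithTop ℕ∞) = 0 + 1 by simp, contDiffOn_succ_iff_fderiv_of_isOpen hΩ]
  refine ⟨fun p hp => (hasFDerivAt_axFun β M n hp).differentiableAt.differentiableWithinAt,
    by simp, ?_⟩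
  rw [contDiffOn_zero]
  have hc : ContinuousOn (fun p : ℝ × E m =>
      axFun β M (n + 1) p • ContinuousLinearMap.fst ℝ ℝ (E m)
      + (-axFun β (M + 1) (n + 2) p / (2 * (M + 1))) •
        (innerSL ℝ p.2).comp (ContinuousLinearMap.snd ℝ ℝ (E m))) {p | ‖p.2‖ < 1} := by
    have h1 := continuousOn_axFun (m := m) β M (n + 1)
    have h2 := continuousOn_axFun (m := m) β (M + 1) (n + 2)
    have h3 : Continuous fun p : ℝ × E m =>
        (innerSL ℝ p.2).comp (ContinuousLinearMap.snd ℝ ℝ (E m)) := by fun_prop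
    exact (h1.smul continuousOn_const).add ((h2.neg.div_const _).smul h3.continuousOn)
  exact hc.congr fun p hp => (hasFDerivAt_axFun β M n hp).fderiv

/-! ### Clifford multiplication and homogeneous monogenic polynomials -/

instance : FiniteDimensional ℝ (Cl m) := (coords m).symm.finiteDimensional

/-- Multiplication of `ℝ_{0,m}` as a continuous bilinear map. -/
def mulCL (m : ℕ) : Cl m →L[ℝ] Cl m →L[ℝ] Cl m := (LinearMap.mul ℝ (Cl m)).toContinuousBilinearMap

theorem mulCL_apply (u v : Cl m) : mulCL m u v = u * v := rfl

/-- The embedding of `ℝ^m` into `ℝ_{0,m}` as a continuous linear map. -/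
def vecCL (m : ℕ) : E m →L[ℝ] Cl m :=
  LinearMap.toContinuousLinearMap (CliffordAlgebra.ι (negNormSq m))

theorem vecCL_apply (x : E m) : vecCL m x = vec x := rfl

theorem vec_mul_vec (x : E m) : (vec x * vec x : Cl m) = algebraMap ℝ (Cl m) (-‖x‖ ^ 2) := by
  rw [vec, CliffordAlgebra.ι_sq_scalar, negNormSq_apply]

theorem e_mul_vec (j : Fin m) (x : E m) :
    (e j * vec x : Cl m) = -(vec x * e j) + algebraMap ℝ (Cl m) (-2 * x j) := by
  rw [← sub_eq_iff_eq_add', sub_neg_eq_add, e, vec, vec, CliffordAlgebra.ι_mul_ι_add_swap]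
  congr 1
  simp only [QuadraticMap.polar, negNormSq_apply, @norm_add_sq_real]
  simp [EuclideanSpace.inner_single_left]
  ring

theorem sum_smul_single (x : E m) : ∑ j, x j • EuclideanSpace.single j (1 : ℝ) = x := by
  ext i
  simp [Pi.single_apply]

theorem sum_smul_e (x : E m) : ∑ j, x j • (e j : Cl m) = vec x := by
  simp only [e, ← vecCL_apply, ← map_smul, ← map_sum, sum_smul_single]

theorem e_mul_self (j : Fin m) : (e j * e j : Cl m) = -1 := by
  rw [e, vec_mul_vec]; simp

namespace IsHomogeneousPolynomial

variable {k : ℕ} {P : E m → Cl m}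

theorem contDiff (hP : IsHomogeneousPolynomial k P) : ContDiff ℝ 1 P := by
  obtain ⟨c, hc⟩ := hP
  rw [funext hc]
  refine ContDiff.sum fun d _ => ?_
  have h : ContDiff ℝ 1 fun x : E m => ∏ j, x j ^ d j :=
    contDiff_prod fun j _ => ContDiff.pow (by fun_prop) _
  exact h.smul contDiff_const

theorem map_smul (hP : IsHomogeneousPolynomial k P) (t : ℝ) (x : E m) :
    P (t • x) = t ^ k • P x := by
  obtain ⟨c, hc⟩ := hP
  rw [hc, hc, Finset.smul_sum]
  refine Finset.sum_congr rfl fun d hd => ?_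
  rw [smul_smul]
  congr 1
  simp only [PiLp.smul_apply, smul_eq_mul, mul_pow, Finset.prod_mul_distrib]
  rw [Finset.prod_pow_eq_pow_sum, (Finset.mem_piAntidiag.1 hd).1]

/-- Euler's identity: differentiate `P(tx) = t^k P(x)` at `t = 1`. -/
theorem fderiv_self (hP : IsHomogeneousPolynomial k P) (x : E m) :
    fderiv ℝ P x x = (k : ℝ) • P x := by
  have hd : HasFDerivAt P (fderiv ℝ P x) ((1 : ℝ) • x) := by
    rw [one_smul]; exact (hP.contDiff.differentiable one_ne_zero x).hasFDerivAt
  have h1 : HasDerivAt (fun t : ℝ => t • x) x 1 := by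
    simpa using (hasDerivAt_id (1 : ℝ)).smul_const x
  have h2 := hd.comp_hasDerivAt 1 h1
  have h3 : HasDerivAt (fun t : ℝ => t ^ k • P x) ((k : ℝ) • P x) 1 := by
    simpa using (hasDerivAt_pow k (1 : ℝ)).smul_const (P x)
  exact h2.unique (h3.congr_of_eventuallyEq (Eventually.of_forall fun t => hP.map_smul t x))

end IsHomogeneousPolynomial

/-- `∂_x (x P) = -(m + 2k) P` for a left monogenic homogeneous polynomial `P`. -/
theorem sum_e_mul_vec_mul {k : ℕ} {P : E m → Cl m} (hP : IsHomogeneousPolynomial k P)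
    (hPmon : ∀ x, dirac P x = 0) (x : E m) :
    ∑ j, e j * (vec (EuclideanSpace.single j 1) * P x
      + vec x * fderiv ℝ P x (EuclideanSpace.single j 1)) = (-(m + 2 * k) : ℝ) • P x := by
  -- `e_j² = -1` produces `-mP` in total; moving `e_j` past `x` leaves `-x ∂_x P = 0` and `-2` times
  -- the Euler derivative.
  have h1 : ∀ j : Fin m, e j * (vec (EuclideanSpace.single j 1) * P x
      + vec x * fderiv ℝ P x (EuclideanSpace.single j 1))
      = -P x - vec x * (e j * fderiv ℝ P x (EuclideanSpace.single j 1))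
        + (-2 : ℝ) • fderiv ℝ P x (x j • EuclideanSpace.single j 1) := fun j => by
    have h2 : e j * (vec (EuclideanSpace.single j 1) * P x) = -P x := by
      rw [← mul_assoc]
      change e j * e j * P x = _
      rw [e_mul_self, neg_one_mul]
    rw [mul_add, h2, ← mul_assoc, e_mul_vec, add_mul, neg_mul, mul_assoc, ← Algebra.smul_def,
      ContinuousLinearMap.map_smul, smul_smul]
    abel
  rw [Finset.sum_congr rfl fun j _ => h1 j, Finset.sum_add_distrib, Finset.sum_sub_distrib,
    ← Finset.mul_sum, ← Finset.smul_sum, ← map_sum, sum_smul_single, hP.fderiv_self]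
  have h3 := hPmon x
  rw [dirac] at h3
  rw [h3]
  simp only [Finset.sum_const, Finset.card_univ, Fintype.card_fin, mul_zero, sub_zero, smul_neg,
    smul_smul]
  rw [← Nat.cast_smul_eq_nsmul ℝ]
  module

/-! ### The monogenic family and its CK series -/

/-- The axial function built from `h^{(n)}` and `P`. -/
def axExt (β : ℝ) (M : ℕ) (P : E m → Cl m) (n : ℕ) (p : ℝ × E m) : Cl m :=
  axFun β M n p • P p.2
    + (axFun β (M + 1) (n + 1) p / (2 * (M + 1))) • (vec p.2 * P p.2)

theorem contDiffOn_axExt (β : ℝ) (M n : ℕ) {P : E m → Cl m} (hP : ContDiff ℝ 1 P) :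
    ContDiffOn ℝ 1 (axExt β M P n) {p | ‖p.2‖ < 1} := by
  have h1 : ContDiff ℝ 1 fun p : ℝ × E m => P p.2 := hP.comp contDiff_snd
  have h2 : ContDiff ℝ 1 fun p : ℝ × E m => vec p.2 * P p.2 :=
    ((mulCL m).contDiff.comp ((vecCL m).contDiff.comp contDiff_snd)).clm_apply h1
  exact ((contDiffOn_axFun β M n).smul h1.contDiffOn).add
    (((contDiffOn_axFun β (M + 1) (n + 1)).div_const _).smul h2.contDiffOn)

theorem fderiv_axExt (β : ℝ) (M n : ℕ) {P : E m → Cl m} (hP : ContDiff ℝ 1 P) {p : ℝ × E m}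
    (hp : ‖p.2‖ < 1) (v : ℝ × E m) :
    fderiv ℝ (axExt β M P n) p v =
      (axFun β M (n + 1) p * v.1
        + -axFun β (M + 1) (n + 2) p / (2 * (M + 1)) * inner ℝ p.2 v.2) • P p.2
      + axFun β M n p • fderiv ℝ P p.2 v.2
      + ((axFun β (M + 1) (n + 2) p * v.1
        + -axFun β (M + 2) (n + 3) p / (2 * (M + 2)) * inner ℝ p.2 v.2) / (2 * (M + 1))) •
          (vec p.2 * P p.2)
      + (axFun β (M + 1) (n + 1) p / (2 * (M + 1))) •
          (vec v.2 * P p.2 + vec p.2 * fderiv ℝ P p.2 v.2) := by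
  have h1 : HasFDerivAt (fun p : ℝ × E m => P p.2) _ p :=
    (hP.differentiable one_ne_zero p.2).hasFDerivAt.comp p hasFDerivAt_snd
  have h2 : HasFDerivAt (fun p : ℝ × E m => vec p.2 * P p.2) _ p :=
    (mulCL m).hasFDerivAt_of_bilinear ((vecCL m).hasFDerivAt.comp p hasFDerivAt_snd) h1
  have h3 := ((hasFDerivAt_axFun β M n hp).smul h1).add
    (((hasFDerivAt_axFun β (M + 1) (n + 1) hp).mul_const (2 * (M + 1) : ℝ)⁻¹).smul h2)
  have h4 : axExt β M P n = ((axFun β M n : ℝ × E m → ℝ) • fun p : ℝ × E m => P p.2)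
      + (fun y : ℝ × E m => axFun β (M + 1) (n + 1) y * (2 * (M + 1) : ℝ)⁻¹) • fun p : ℝ × E m => vec p.2 * P p.2 := by
    funext q
    simp [axExt, div_eq_mul_inv]
  rw [h4, h3.fderiv]
  have h5 : (M : ℝ) + 1 + 1 = M + 2 := by ring
  simp [mulCL_apply, vecCL_apply, div_eq_mul_inv]
  simp only [Nat.add_assoc, Nat.reduceAdd, h5]
  module

/-- `h` is even, and each differentiation flips the parity. -/
theorem powQ_neg (β : ℝ) (n : ℕ) {z : ℂ} (hz : z ∈ strip) :
    powQ β n (-z) = (-1) ^ n * powQ β n z := by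
  induction n generalizing z with
  | zero => simp [powQ, Q]
  | succ n ih =>
    have hz' : -z ∈ strip := by simpa [strip] using hz
    have h1 : HasDerivAt (fun z => powQ β n (-z)) (-powQ β (n + 1) (-z)) z := by
      exact ((hasDerivAt_powQ β n hz').comp z (hasDerivAt_neg z)).congr_deriv (by ring)
    have h2 := (hasDerivAt_powQ β n hz).const_mul ((-1) ^ n)
    have h3 : (fun z => powQ β n (-z)) =ᶠ[𝓝 z] fun z => (-1) ^ n * powQ β n z := by
      filter_upwards [isOpen_strip.mem_nhds hz] with s hs using ih hs
    have := h1.unique (h2.congr_of_eventuallyEq h3)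
    rw [pow_succ]
    linear_combination -this

theorem axInt_zero_left_of_odd (β : ℝ) (M n : ℕ) (hn : Odd n) {r : ℂ} (hr : ‖r‖ < 1) :
    axInt β M n 0 r = 0 := by
  have h : |(0 : ℂ).im| + ‖r‖ < 1 := by simpa using hr
  have e : axInt β M n 0 r = -axInt β M n 0 r := by
    have e1 := intervalIntegral.integral_comp_neg (a := -1) (b := 1)
      (fun t : ℝ => powQ β n (0 + Complex.I * r * t) * (wt M).eval (t : ℂ))
    rw [neg_neg] at e1
    rw [axInt, stripInt, ← intervalIntegral.integral_neg, ← e1]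
    refine intervalIntegral.integral_congr fun t ht => ?_
    rw [uIcc_of_le (by norm_num)] at ht
    have h1 := powQ_neg β n (segment_mem_strip h ht)
    simp only [zero_add] at h1
    simp only [zero_add, Complex.ofReal_neg, mul_neg]
    rw [h1, hn.neg_one_pow]
    simp [wt]
  exact self_eq_neg.1 e

theorem axFun_zero_left_of_odd (β : ℝ) (M n : ℕ) (hn : Odd n) {x : E m} (hx : ‖x‖ < 1) :
    axFun β M n (0, x) = 0 := by
  have := axInt_zero_left_of_odd β M n hn (r := ((‖x‖ : ℝ) : ℂ)) (by simpa using hx)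
  simp [axFun, this]

variable {k M : ℕ} {P : E m → Cl m}

theorem fderiv_axExt_fst (β : ℝ) (n : ℕ) (hP : IsHomogeneousPolynomial k P) {p : ℝ × E m}
    (hp : ‖p.2‖ < 1) : fderiv ℝ (axExt β M P n) p (1, 0) = axExt β M P (n + 1) p := by
  rw [fderiv_axExt β M n hP.contDiff hp, ← vecCL_apply 0]
  simp [axExt]

/-- The gradient of the scalar coefficient of `P` supplies the new `xP` part. The new `P` part
combines `x · x = -|x|²` with `∂_x (x P)`. -/
theorem sum_e_mul_fderiv_axExt (β : ℝ) (n : ℕ) (hP : IsHomogeneousPolynomial k P)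
    (hPmon : ∀ x, dirac P x = 0) (hM : m + 2 * k = 2 * M + 3) {p : ℝ × E m} (hp : ‖p.2‖ < 1) :
    ∑ j, e j * fderiv ℝ (axExt β M P n) p (0, EuclideanSpace.single j 1)
      = -axExt β M P (n + 1) p := by
  set c₁ : ℝ := -axFun β (M + 1) (n + 2) p / (2 * (M + 1)) with hc₁
  set c₂ : ℝ := -axFun β (M + 2) (n + 3) p / (2 * (M + 2)) / (2 * (M + 1)) with hc₂
  set B : ℝ := axFun β (M + 1) (n + 1) p / (2 * (M + 1)) with hB
  have h1 : ∀ j : Fin m, e j * fderiv ℝ (axExt β M P n) p (0, EuclideanSpace.single j 1)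
      = c₁ • ((p.2 j • e j) * P p.2)
        + axFun β M n p • (e j * fderiv ℝ P p.2 (EuclideanSpace.single j 1))
        + c₂ • ((p.2 j • e j) * (vec p.2 * P p.2))
        + B • (e j * (vec (EuclideanSpace.single j 1) * P p.2
          + vec p.2 * fderiv ℝ P p.2 (EuclideanSpace.single j 1))) := fun j => by
    rw [fderiv_axExt β M n hP.contDiff hp]
    simp only [mul_zero, zero_add, EuclideanSpace.inner_single_right, one_mul,
      conj_trivial, mul_add, mul_smul_comm, smul_mul_assoc, smul_smul, smul_add]
    rw [hc₁, hc₂, hB]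
    module
  have h2 : ∑ j, e j * fderiv ℝ P p.2 (EuclideanSpace.single j 1) = 0 := hPmon p.2
  have h3 : vec p.2 * (vec p.2 * P p.2) = (-‖p.2‖ ^ 2) • P p.2 := by
    rw [← mul_assoc, vec_mul_vec, ← Algebra.smul_def]
  rw [Finset.sum_congr rfl fun j _ => h1 j, Finset.sum_add_distrib, Finset.sum_add_distrib,
    Finset.sum_add_distrib, ← Finset.smul_sum, ← Finset.smul_sum, ← Finset.smul_sum,
    ← Finset.smul_sum, ← Finset.sum_mul, ← Finset.sum_mul, sum_smul_e, h2,
    sum_e_mul_vec_mul hP hPmon, h3, smul_zero, add_zero, smul_smul, smul_smul]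
  -- This is the recurrence at `n + 1`; it matches only because `m + 2k = 2M + 3`.
  have h4 : c₂ * -‖p.2‖ ^ 2 + B * -(m + 2 * k) = -axFun β M (n + 1) p := by
    have hM' : (m + 2 * k : ℝ) = 2 * M + 3 := by exact_mod_cast hM
    have h5 := axFun_recurrence β M (n + 1) hp
    rw [hM', hc₂, hB]
    field_simp
    linear_combination h5
  have h6 : axFun β (M + 1) (n + 1 + 1) p / (2 * (M + 1)) = -c₁ := by rw [hc₁]; ring
  rw [axExt, h6, ← neg_eq_iff_eq_neg.2 h4]
  module

theorem differentiableAt_axExt (β : ℝ) (M n : ℕ) (hP : IsHomogeneousPolynomial k P) {p : ℝ × E m}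
    (hp : ‖p.2‖ < 1) : DifferentiableAt ℝ (axExt β M P n) p := by
  have hΩ : IsOpen {p : ℝ × E m | ‖p.2‖ < 1} := isOpen_lt (by fun_prop) continuous_const
  exact ((contDiffOn_axExt β M n hP.contDiff).contDiffAt (hΩ.mem_nhds hp)).differentiableAt
    one_ne_zero

theorem dirac_axExt (β : ℝ) (n : ℕ) (hP : IsHomogeneousPolynomial k P)
    (hPmon : ∀ x, dirac P x = 0) (hM : m + 2 * k = 2 * M + 3) (c : ℝ) {x : E m} (hx : ‖x‖ < 1) :
    dirac (fun x => c • axExt β M P n (0, x)) x = -c • axExt β M P (n + 1) (0, x) := by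
  have h1 := (differentiableAt_axExt β M n hP (p := (0, x)) hx).hasFDerivAt
  have h0 : HasFDerivAt (fun x : E m => ((0 : ℝ), x)) (ContinuousLinearMap.inr ℝ ℝ (E m)) x :=
    (hasFDerivAt_const (0 : ℝ) x).prodMk (hasFDerivAt_id x)
  have h2 : HasFDerivAt (fun x => c • axExt β M P n (0, x))
      (c • (fderiv ℝ (axExt β M P n) (0, x)).comp (ContinuousLinearMap.inr ℝ ℝ (E m))) x :=
    HasFDerivAt.const_smul (HasFDerivAt.comp x h1 h0) c
  rw [dirac, h2.fderiv]
  simp only [_root_.smul_apply, ContinuousLinearMap.comp_apply,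
    ContinuousLinearMap.inr_apply, mul_smul_comm]
  rw [← Finset.smul_sum, sum_e_mul_fderiv_axExt β n hP hPmon hM (p := (0, x)) hx, smul_neg,
    neg_smul]

theorem iterate_dirac_axExt (β : ℝ) (n : ℕ) (hP : IsHomogeneousPolynomial k P)
    (hPmon : ∀ x, dirac P x = 0) (hM : m + 2 * k = 2 * M + 3) (c : ℝ) {g : E m → Cl m}
    (hg : ∀ x, ‖x‖ < 1 → g x = c • axExt β M P n (0, x)) (l : ℕ) {x : E m} (hx : ‖x‖ < 1) :
    (dirac^[l] g) x = ((-1) ^ l * c) • axExt β M P (n + l) (0, x) := by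
  induction l generalizing x with
  | zero => simpa using hg x hx
  | succ l ih =>
    -- The formula is known only in the ball, but the Dirac operator is local.
    have h1 : dirac^[l] g =ᶠ[𝓝 x] fun x => ((-1) ^ l * c) • axExt β M P (n + l) (0, x) := by
      filter_upwards [(isOpen_lt continuous_norm continuous_const).mem_nhds hx] with y hy
      exact ih hy
    have h2 : dirac (dirac^[l] g) x
        = dirac (fun x => ((-1) ^ l * c) • axExt β M P (n + l) (0, x)) x := by
      rw [dirac, dirac, h1.fderiv_eq]
    rw [Function.iterate_succ_apply', h2, dirac_axExt β (n + l) hP hPmon hM _ hx, pow_succ,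
      add_assoc]
    congr 1
    ring

theorem monogenicOn_axExt (β : ℝ) (n : ℕ) (hP : IsHomogeneousPolynomial k P)
    (hPmon : ∀ x, dirac P x = 0) (hM : m + 2 * k = 2 * M + 3) (c : ℝ) :
    MonogenicOn (fun p => c • axExt β M P n p) {p | ‖p.2‖ < 1} := by
  refine ⟨(contDiffOn_axExt β M n hP.contDiff).const_smul c, fun p hp => ?_⟩
  have h2 : HasFDerivAt (fun p => c • axExt β M P n p) (c • fderiv ℝ (axExt β M P n) p) p :=
    (differentiableAt_axExt β M n hP hp).hasFDerivAt.const_smul c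
  rw [cauchyRiemann, h2.fderiv]
  simp only [_root_.smul_apply, mul_smul_comm]
  rw [← Finset.smul_sum, sum_e_mul_fderiv_axExt β n hP hPmon hM hp, fderiv_axExt_fst β n hP hp,
    ← smul_add, add_neg_cancel, smul_zero]

theorem hasSum_axExt (β : ℝ) (M n : ℕ) (P : E m → Cl m) {p : ℝ × E m} (hp : |p.1| + ‖p.2‖ < 1) :
    HasSum (fun l : ℕ => (p.1 ^ l / (l ! : ℝ)) • axExt β M P (n + l) (0, p.2))
      (axExt β M P n p) := by
  have h1 := (hasSum_axFun β M n hp).smul_const (P p.2)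
  have h2 := ((hasSum_axFun β (M + 1) (n + 1) hp).div_const (2 * (M + 1) : ℝ)).smul_const
    (vec p.2 * P p.2)
  have h3 := h1.add h2
  have e : (fun l : ℕ => (p.1 ^ l / (l ! : ℝ)) • axExt β M P (n + l) (0, p.2))
      = fun l : ℕ => (p.1 ^ l / (l ! : ℝ) * axFun β M (n + l) (0, p.2)) • P p.2
        + (p.1 ^ l / (l ! : ℝ) * axFun β (M + 1) (n + 1 + l) (0, p.2) / (2 * (M + 1))) •
          (vec p.2 * P p.2) := by
    funext l
    rw [axExt, smul_add, smul_smul, smul_smul, mul_div_assoc, Nat.add_right_comm n 1 l]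
  rw [e]
  exact h3

/-! ### Constants and the main theorem -/

theorem prod_range_sub_eq (α : ℝ) (N : ℕ) :
    ∏ j ∈ Finset.range N, (α + (N : ℕ) - j) = ∏ n ∈ Finset.Icc 1 N, (α + (n : ℝ)) := by
  rw [← Finset.prod_range_reflect, ← Finset.Ico_succ_right_eq_Icc, Finset.prod_Ico_eq_prod_range]
  refine Finset.prod_congr (by simp) fun j hj => ?_
  have hj' : j < N := Finset.mem_range.1 hj
  have : ((N - 1 - j : ℕ) : ℝ) = N - 1 - j := by
    rw [Nat.sub_sub, Nat.cast_sub (by omega)]; push_cast; ring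
  rw [this]
  push_cast
  ring

end CliffordCK

end

theorem mainTheorem3 (m k : ℕ) (hm : Odd m) (hmk : m ≠ 1 ∨ k ≠ 0)
    (P : CliffordCK.E m → CliffordCK.Cl m)
    (hP : CliffordCK.IsHomogeneousPolynomial k P)
    (hPmon : ∀ x, CliffordCK.dirac P x = 0)
    (α : ℝ) (hα : ∀ j ∈ Finset.Icc 1 (k + (m - 1) / 2), α ≠ -(j : ℝ)) :
    ∃ F : ℝ × CliffordCK.E m → CliffordCK.Cl m,
      -- `F` is the Cauchy-Kowalevski extension of `(1 - |x|²)^α P(x)`, `|x| < 1`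
      CliffordCK.MonogenicOn F {p | ‖p.2‖ < 1} ∧
      (∀ x : CliffordCK.E m, ‖x‖ < 1 → F (0, x) = CliffordCK.weighted α P x) ∧
      (∀ p : ℝ × CliffordCK.E m, |p.1| + ‖p.2‖ < 1 →
        HasSum (CliffordCK.ckTerm (CliffordCK.weighted α P) p) (F p)) ∧
      -- the closed formula, in which both complex sums are real numbers
      (∀ (x₀ : ℝ) (x : CliffordCK.E m), 0 < ‖x‖ → ‖x‖ < 1 →
        ∃ s t : ℝ, (s : ℂ) = CliffordCK.sumA m k α x₀ ‖x‖ ∧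
          (t : ℂ) = CliffordCK.sumB m k α x₀ ‖x‖ ∧
          (2 ^ (k + (m + 1) / 2) *
              ∏ n ∈ Finset.Icc 1 (k + (m - 1) / 2), (α + (n : ℝ))) • F (x₀, x) =
            (algebraMap ℝ (CliffordCK.Cl m) s
              + t • (‖x‖⁻¹ • CliffordCK.vec x)) * P x) := by
  open CliffordCK in
  obtain ⟨q, hq⟩ := hm
  -- Excluding `(m, k) = (1, 0)` gives `k + q ≥ 1`, so this subtraction does not truncate.
  obtain ⟨M, hM⟩ : ∃ M, k + q = M + 1 := ⟨k + q - 1, by omega⟩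
  have hdim : m + 2 * k = 2 * M + 3 := by omega
  rw [show k + (m - 1) / 2 = M + 1 by omega] at hα ⊢
  rw [show k + (m + 1) / 2 = M + 2 by omega]
  set β : ℝ := α + (M + 1 : ℕ) with hβ
  set D : ℝ := ∏ n ∈ Finset.Icc 1 (M + 1), (α + (n : ℝ)) with hD
  have hD0 : D ≠ 0 := Finset.prod_ne_zero_iff.2 fun n hn h => hα n hn (by linarith)
  -- The constant of `axInt_zero_left`, since the product of the `β - j` is `D`; it is nonzero by
  -- the assumption on `α`.
  set c : ℝ := 4 ^ (M + 1) * (M ! : ℝ) * D with hc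
  have hM0 : (M ! : ℝ) ≠ 0 := by exact_mod_cast Nat.factorial_ne_zero M
  have hc0 : c ≠ 0 := mul_ne_zero (mul_ne_zero (by positivity) hM0) hD0
  have hinit : ∀ x : E m, ‖x‖ < 1 → weighted α P x = c⁻¹ • axExt β M P (2 * M + 2) (0, x) := by
    intro x hx
    rw [axExt, axFun_zero_left_of_odd β (M + 1) (2 * M + 2 + 1) ⟨M + 1, by ring⟩ hx,
      axFun_zero_left β M hx, hβ, prod_range_sub_eq, add_sub_cancel_right, ← hD, ← hc, weighted,
      zero_div, zero_smul, add_zero, smul_smul, inv_mul_cancel_left₀ hc0]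
  refine ⟨fun p => c⁻¹ • axExt β M P (2 * M + 2) p,
    monogenicOn_axExt β _ hP hPmon hdim _, fun x hx => (hinit x hx).symm, fun p hp => ?_,
    fun x₀ x hx0 hx1 => ?_⟩
  · have hx : ‖p.2‖ < 1 := by linarith [abs_nonneg p.1]
    have h1 := (hasSum_axExt β M (2 * M + 2) P hp).const_smul c⁻¹
    have e : ckTerm (weighted α P) p = fun l : ℕ =>
        c⁻¹ • (p.1 ^ l / (l ! : ℝ)) • axExt β M P (2 * M + 2 + l) (0, p.2) := by
      funext l
      rw [ckTerm, iterate_dirac_axExt β (2 * M + 2) hP hPmon hdim c⁻¹ hinit l hx, smul_smul,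
        smul_smul, neg_pow]
      congr 1
      -- The sign of `(-x₀)^l` cancels the sign of the iterated Dirac operator.
      have h2 : ((-1 : ℝ) ^ l) * (-1) ^ l = 1 := by rw [← mul_pow]; simp
      linear_combination (p.1 ^ l / (l ! : ℝ) * c⁻¹) * h2
    rw [e]
    exact h1
  · have hA := sumA_eq hq hM α x₀ ‖x‖ hx0 hx1
    have hB := sumB_eq hq hM α x₀ ‖x‖ hx0 hx1
    rw [← hβ, ← ofReal_axFun β _ _ (p := (x₀, x)) hx1] at hA hB
    have hM1 : ((M + 1)! : ℝ) ≠ 0 := by exact_mod_cast Nat.factorial_ne_zero (M + 1)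
    have hM0' : (M ! : ℂ) ≠ 0 := by exact_mod_cast hM0
    have hM1' : ((M + 1)! : ℂ) ≠ 0 := by exact_mod_cast hM1
    refine ⟨axFun β M (2 * M + 2) (x₀, x) / (2 ^ M * M !),
      ‖x‖ * axFun β (M + 1) (2 * M + 3) (x₀, x) / (2 ^ (M + 1) * (M + 1)!), ?_, ?_, ?_⟩
    · push_cast
      rw [← hA]
      field_simp
    · push_cast
      rw [← hB]
      field_simp
    · have h4 : (4 : ℝ) ^ (M + 1) = 2 ^ M * 2 ^ (M + 2) := by
        rw [← pow_add, show M + (M + 2) = 2 * (M + 1) by ring, pow_mul]; norm_num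
      -- The prefactor over `c` is exactly the normalisation `1/(2^M M!)` of `sumA_eq`; the further
      -- `1/(2(M+1))` in `axExt` turns it into that of `sumB_eq`.
      have hk : 2 ^ (M + 2) * D * c⁻¹ = (2 ^ M * (M ! : ℝ))⁻¹ := by
        rw [hc, h4]
        field_simp
      rw [smul_smul, hk, axExt, smul_add, smul_smul, smul_smul, add_mul, ← Algebra.smul_def,
        smul_smul, smul_mul_assoc]
      congr 2
      · rw [div_eq_inv_mul]
      · rw [Nat.factorial_succ, pow_succ]
        have := hx0.ne'
        push_cast
        field_simp
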